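/- Let $G$ be a torsion-free word hyperbolic group. Then $G$ is noncommutatively slender: for every homomorphism $\phi:\mathrm{HEG}\to G$ there is $N\in\{0,1,2,\dots\}$ such that $\phi=\phi\circ p_N$. Here the notions are as follows. A finitely generated group $G$ is *word hyperbolic* if, for some finite generating set $X$, its Cayley graph $\Gamma(G,X)$ with the combinatorial path metric $d$ is hyperbolic, i.e. there is $\delta$ such that $(x,z)_p\ge\min\{(x,y)_p,(y,z)_p\}-\delta$ for all $p,x,y,z$, where $(x,y)_p=\frac12\bigl(d(x,p)+d(y,p)-d(x,y)\bigr)$; it suffices to require this for vertices $p,x,y,z$, that is, for $G$ with its word metric. *Torsion-free* means that no element other than $1$ has finite order. Let $\{a_n^{\pm1}\}_{n\ge 0}$ be letters with formal inverses. A *word* is a map $W$ from a countable totally ordered set $\overline W$ to the set of letters such that $W^{-1}(\{a_n,a_n^{-1}\})$ is finite for each $n$. For $N\ge 0$ let $p_N(W)$ be the finite word obtained by restricting $W$ to the positions $t$ with $W(t)\in\{a_0^{\pm1},\dots,a_N^{\pm1}\}$. Put $U\sim V$ if $p_N(U)=p_N(V)$ in the free group $F(a_0,\dots,a_N)$ for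 every $N\ge 0$. The *Hawaiian earring group* $\mathrm{HEG}$ is the set of $\sim$-classes of words, with concatenation as product; the inverse of a word is obtained by reversing the order and inverting each letter, and the identity is the class of the empty word. The free group $\mathrm{HEG}_N=F(a_0,\dots,a_N)$ is viewed as a subgroup of $\mathrm{HEG}$ via $a_i\mapsto[a_i]$, and $p_N:\mathrm{HEG}\to\mathrm{HEG}_N\le\mathrm{HEG}$ is the retraction induced by $W\mapsto p_N(W)$. -/

import Mathlib

/-! ### Words and the Hawaiian earring group -/

/-- A word in the letters `a₀^{±1}, a₁^{±1}, …`: a map from a countable totally ordered set to the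
letters that takes each value `a_n^{±1}` only finitely often. The letter `a_n` is `(n, true)` and
its formal inverse is `(n, false)`, as in `FreeGroup.mk`. Every countable order type is realized
by a domain in `Type`. -/
structure HEWord : Type 1 where
  Dom : Type
  [order : LinearOrder Dom]
  [countable : Countable Dom]
  letter : Dom → ℕ × Bool
  finite_letter : ∀ n : ℕ, {t | (letter t).1 = n}.Finite

attribute [instance] HEWord.order HEWord.countable

namespace HEWord

lemma finite_le (W : HEWord) (N : ℕ) : {t | (W.letter t).1 ≤ N}.Finite := by
  have h : {t | (W.letter t).1 ≤ N} = ⋃ n ∈ Set.Iic N, {t | (W.letter t).1 = n} := by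
    ext t; simp
  rw [h]
  exact (Set.finite_Iic N).biUnion fun n _ => W.finite_letter n

/-- The positions of the word that carry one of the letters `a₀^{±1}, …, a_N^{±1}`. -/
noncomputable def positions (W : HEWord) (N : ℕ) : Finset W.Dom := (W.finite_le N).toFinset

@[simp] lemma mem_positions (W : HEWord) (N : ℕ) (t : W.Dom) :
    t ∈ W.positions N ↔ (W.letter t).1 ≤ N := by simp [positions]

/-- The element of the free group on `a₀, …, a_N` given by a single letter `a_n^{±1}`, `n ≤ N`
(letters of larger index are sent to `1`). -/
def letterVal (N : ℕ) (x : ℕ × Bool) : FreeGroup (Fin (N + 1)) :=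
  if h : x.1 ≤ N then FreeGroup.mk [(⟨x.1, Nat.lt_succ_of_le h⟩, x.2)] else 1

/-- The element of the free group on `a₀, …, a_N` that is represented by the finite word obtained
from `W` by keeping only the letters `a₀^{±1}, …, a_N^{±1}`, read in increasing order. -/
noncomputable def proj (N : ℕ) (W : HEWord) : FreeGroup (Fin (N + 1)) :=
  (((W.positions N).sort (· ≤ ·)).map fun t => letterVal N (W.letter t)).prod

/-- The empty word. -/
def empty : HEWord where
  Dom := Empty
  letter := Empty.elim
  finite_letter _ := Set.toFinite _

/-- The word of length one. -/
def single (x : ℕ × Bool) : HEWord where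
  Dom := Unit
  letter _ := x
  finite_letter _ := Set.toFinite _

/-- Concatenation: all positions of `U` come before all positions of `V`. -/
def concat (U V : HEWord) : HEWord where
  Dom := U.Dom ⊕ₗ V.Dom
  countable := inferInstanceAs (Countable (U.Dom ⊕ V.Dom))
  letter t := Sum.elim U.letter V.letter (ofLex t)
  finite_letter n := by
    refine (((U.finite_letter n).image (fun t => toLex (Sum.inl t))).union
      ((V.finite_letter n).image (fun t => toLex (Sum.inr t)))).subset ?_
    intro t ht
    rcases h : ofLex t with u | v
    · exact Or.inl ⟨u, by simpa [h] using ht, congrArg toLex h.symm⟩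
    · exact Or.inr ⟨v, by simpa [h] using ht, congrArg toLex h.symm⟩

/-- The inverse word: the order is reversed and every letter is inverted. -/
def inverse (U : HEWord) : HEWord where
  Dom := U.Domᵒᵈ
  countable := inferInstanceAs (Countable U.Dom)
  letter t := ((U.letter (OrderDual.ofDual t)).1, !(U.letter (OrderDual.ofDual t)).2)
  finite_letter n := U.finite_letter n

/-- The projection can be computed from any strictly increasing enumeration of the positions. -/
lemma proj_eq_of_list (N : ℕ) (W : HEWord) (l : List W.Dom) (hl : l.Pairwise (· < ·))
    (hmem : ∀ t, t ∈ l ↔ (W.letter t).1 ≤ N) :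
    proj N W = (l.map fun t => letterVal N (W.letter t)).prod := by
  have key : (W.positions N).sort (· ≤ ·) = l := by
    refine List.Perm.eq_of_pairwise' (r := (· ≤ ·)) (Finset.pairwise_sort _ _)
      (hl.imp fun h => h.le) ?_
    rw [List.perm_ext_iff_of_nodup (Finset.sort_nodup _ _) (hl.imp fun h => h.ne)]
    intro t
    rw [Finset.mem_sort, mem_positions, hmem]
  rw [proj, key]

lemma proj_empty (N : ℕ) : proj N empty = 1 :=
  proj_eq_of_list N empty [] List.Pairwise.nil fun t => Empty.elim t

lemma pairwise_sort_lt (W : HEWord) (N : ℕ) :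
    ((W.positions N).sort (· ≤ ·)).Pairwise (· < ·) :=
  (Finset.sortedLT_sort _).pairwise

/-- The positions of `U` in `UV`. -/
def inl (U V : HEWord) (t : U.Dom) : (concat U V).Dom := toLex (Sum.inl t)

/-- The positions of `V` in `UV`. -/
def inr (U V : HEWord) (t : V.Dom) : (concat U V).Dom := toLex (Sum.inr t)

lemma proj_concat (N : ℕ) (U V : HEWord) :
    proj N (concat U V) = proj N U * proj N V := by
  rw [proj_eq_of_list N (concat U V)
    (((U.positions N).sort (· ≤ ·)).map (inl U V) ++ ((V.positions N).sort (· ≤ ·)).map (inr U V)),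
    List.map_append, List.prod_append, List.map_map, List.map_map]
  · rfl
  · rw [List.pairwise_append, List.pairwise_map, List.pairwise_map]
    refine ⟨(pairwise_sort_lt U N).imp fun h => Sum.Lex.inl_lt_inl_iff.2 h,
      (pairwise_sort_lt V N).imp fun h => Sum.Lex.inr_lt_inr_iff.2 h, ?_⟩
    intro a ha b hb
    rw [List.mem_map] at ha hb
    obtain ⟨u, -, rfl⟩ := ha
    obtain ⟨v, -, rfl⟩ := hb
    exact Sum.Lex.inl_lt_inr u v
  · intro t
    rw [List.mem_append, List.mem_map, List.mem_map]
    simp only [Finset.mem_sort, mem_positions]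
    constructor
    · rintro (⟨u, hu, rfl⟩ | ⟨v, hv, rfl⟩)
      · exact hu
      · exact hv
    · intro h
      rcases t with u | v
      · exact Or.inl ⟨u, h, rfl⟩
      · exact Or.inr ⟨v, h, rfl⟩

lemma letterVal_inv (N : ℕ) (x : ℕ × Bool) :
    letterVal N (x.1, !x.2) = (letterVal N x)⁻¹ := by
  unfold letterVal
  by_cases h : x.1 ≤ N <;> simp [h, FreeGroup.inv_mk, FreeGroup.invRev]

lemma proj_inverse (N : ℕ) (U : HEWord) : proj N (inverse U) = (proj N U)⁻¹ := by
  let e : U.Dom → (inverse U).Dom := OrderDual.toDual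
  rw [proj_eq_of_list N (inverse U) (((U.positions N).sort (· ≤ ·)).map e).reverse,
    List.map_reverse, List.map_map, proj, List.prod_inv_reverse, List.map_map]
  · congr 2
    exact List.map_congr_left fun t _ => letterVal_inv N (U.letter t)
  · rw [List.pairwise_reverse, List.pairwise_map]
    exact (pairwise_sort_lt U N).imp fun h => OrderDual.toDual_lt_toDual.2 h
  · intro t
    rw [List.mem_reverse, List.mem_map]
    simp only [Finset.mem_sort, mem_positions]
    constructor
    · rintro ⟨u, hu, rfl⟩
      exact hu
    · intro h
      exact ⟨OrderDual.ofDual t, h, rfl⟩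

/-- Two words are equivalent if for every `N` their projections to the letters
`a₀^{±1}, …, a_N^{±1}` agree in the free group on `a₀, …, a_N`. Isomorphic words are in
particular equivalent. -/
instance setoid : Setoid HEWord where
  r U V := ∀ N : ℕ, proj N U = proj N V
  iseqv := ⟨fun _ _ => rfl, fun h N => (h N).symm, fun h k N => (h N).trans (k N)⟩

end HEWord

/-- The Hawaiian earring group: words modulo equivalence. -/
def HEG : Type 1 := Quotient HEWord.setoid

namespace HEG

instance : Group HEG where
  mul := Quotient.map₂ HEWord.concat fun _ _ h _ _ k N => by
    rw [HEWord.proj_concat, HEWord.proj_concat, h N, k N]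
  one := Quotient.mk _ HEWord.empty
  inv := Quotient.map HEWord.inverse fun _ _ h N => by
    rw [HEWord.proj_inverse, HEWord.proj_inverse, h N]
  mul_assoc := by
    rintro ⟨U⟩ ⟨V⟩ ⟨W⟩
    exact Quotient.sound fun N => by simp only [HEWord.proj_concat, mul_assoc]
  one_mul := by
    rintro ⟨U⟩
    exact Quotient.sound fun N => by simp only [HEWord.proj_concat, HEWord.proj_empty, one_mul]
  mul_one := by
    rintro ⟨U⟩
    exact Quotient.sound fun N => by simp only [HEWord.proj_concat, HEWord.proj_empty, mul_one]
  inv_mul_cancel := by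
    rintro ⟨U⟩
    exact Quotient.sound fun N => by
      simp only [HEWord.proj_concat, HEWord.proj_inverse, HEWord.proj_empty, inv_mul_cancel]

/-- The class of a word. -/
def mk (W : HEWord) : HEG := Quotient.mk _ W

/-- The projection `p_N` from the Hawaiian earring group to the free group on `a₀, …, a_N`. -/
noncomputable def proj (N : ℕ) : HEG →* FreeGroup (Fin (N + 1)) where
  toFun := Quotient.lift (HEWord.proj N) fun _ _ h => h N
  map_one' := HEWord.proj_empty N
  map_mul' := by
    rintro ⟨U⟩ ⟨V⟩
    exact HEWord.proj_concat N U V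

/-- The inclusion of the free group on `a₀, …, a_N` in the Hawaiian earring group; it sends `a_i`
to the class of the one-letter word `a_i`. -/
def incl (N : ℕ) : FreeGroup (Fin (N + 1)) →* HEG :=
  FreeGroup.lift fun i => mk (HEWord.single (i.val, true))

end HEG

/-- A group `G` is noncommutatively slender if every homomorphism `φ` from the Hawaiian earring
group to `G` satisfies `φ = φ ∘ p_N` for some `N`, where `p_N` is viewed as a retraction onto the
free subgroup on `a₀, …, a_N`. -/
def IsNSlender (G : Type*) [Group G] : Prop :=
  ∀ φ : HEG →* G, ∃ N : ℕ, φ = φ.comp ((HEG.incl N).comp (HEG.proj N))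

/-! ### Word hyperbolic groups -/

/-- The Gromov product `(x, y)_p` with respect to a distance function `d`. -/
noncomputable def gromovProduct {Z : Type*} (d : Z → Z → ℝ) (p x y : Z) : ℝ :=
  (d x p + d y p - d x y) / 2

/-- Gromov hyperbolicity of a distance function. -/
def IsGromovHyperbolic {Z : Type*} (d : Z → Z → ℝ) : Prop :=
  ∃ δ : ℝ, ∀ p x y z : Z,
    min (gromovProduct d p x y) (gromovProduct d p y z) - δ ≤ gromovProduct d p x z

/-- A group is word hyperbolic if, for some finite generating set `X`, its Cayley graph with
respect to `X` is hyperbolic for the combinatorial path metric. The condition is imposed on the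
vertices of the Cayley graph, that is, on the group with its word metric; every point of an edge
is within `1/2` of a vertex, so this only affects the value of `δ`. -/
def IsWordHyperbolic (G : Type*) [Group G] : Prop :=
  ∃ X : Set G, X.Finite ∧ Subgroup.closure X = ⊤ ∧
    IsGromovHyperbolic fun g h : G => ((SimpleGraph.mulCayley X).dist g h : ℝ)

/-! Suppose `φ` factors through no `p_N`. Then for each n some word w_n in letters of index greater
than n has φ(w_n) ≠ 1: any word is a finite product of letters of index at most N and words in
letters of larger index, so otherwise `φ` would be determined by its values on a_0, …, a_N
(`HEG.eq_comp_proj`). For any exponents k_n, the group `HEG` contains a solution of the infinite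
system x_n = w_n x_{n+1}^{k_n} (`HEG.exists_nested_powers`).

On the side of `G`, `exists_pow_length_ge` gives for every L a single exponent k with ℓ(g^k) ≥ ℓ(g)
+ L for all g ≠ 1. With k_n chosen for L = ℓ(φ(w_n)) + 1, the system forces every φ(x_n) to be
nontrivial and ℓ(φ(x_{n+1})) ≤ ℓ(φ(x_n)) - 1, an infinite descent of nonnegative lengths.

The uniform exponent comes from a dichotomy. If g² is clearly longer than g, the lengths of powers
of g grow at a definite rate. Otherwise g is conjugate to an element c of a fixed finite ball, and
conjugation by a shortest-type conjugator adds nearly its full length on both sides of c^k.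
Torsion-freeness and finiteness of the ball make ℓ(c^k) large for all such c at once. -/

/-! ### Lengths of powers in torsion-free hyperbolic groups -/

/-- A length function on a group whose left-invariant distance `d x y = ℓ (x⁻¹ * y)` satisfies the
four-point condition with constant `D`, has finite balls and has approximate midpoints. -/
structure IsHyperbolicLength {G : Type*} [Group G] (ℓ : G → ℝ) (D : ℝ) : Prop where
  map_one : ℓ 1 = 0
  map_inv : ∀ g, ℓ g⁻¹ = ℓ g
  map_mul_le : ∀ g h, ℓ (g * h) ≤ ℓ g + ℓ h
  four_point : ∀ x y z w : G,
    ℓ (x⁻¹ * z) + ℓ (y⁻¹ * w) ≤ ℓ (x⁻¹ * y) + ℓ (z⁻¹ * w) + D ∨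
    ℓ (x⁻¹ * z) + ℓ (y⁻¹ * w) ≤ ℓ (x⁻¹ * w) + ℓ (y⁻¹ * z) + D
  finite_ball : ∀ R, {g | ℓ g ≤ R}.Finite
  exists_midpoint : ∀ g, ∃ u v, g = u * v ∧ ℓ u + ℓ v = ℓ g ∧ 2 * ℓ u ≤ ℓ g ∧ ℓ g ≤ 2 * ℓ u + 1

namespace IsHyperbolicLength

variable {G : Type*} [Group G] {ℓ : G → ℝ} {D : ℝ}

lemma nonneg (h : IsHyperbolicLength ℓ D) (g : G) : 0 ≤ ℓ g := by
  have := h.map_mul_le g g⁻¹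
  rw [mul_inv_cancel, h.map_one, h.map_inv] at this
  linarith

lemma const_nonneg (h : IsHyperbolicLength ℓ D) : 0 ≤ D := by
  have := h.four_point 1 1 1 1
  simp only [inv_one, mul_one, h.map_one] at this
  rcases this with h | h <;> linarith

/-- If `g²` is sufficiently longer than `g`, then the lengths of the powers of `g` grow. -/
lemma add_le_pow_succ (h : IsHyperbolicLength ℓ D) {g : G} (hg : ℓ g + D + 1 ≤ ℓ (g ^ 2)) (n : ℕ) :
    ℓ g + n ≤ ℓ (g ^ (n + 1)) := by
  have hD := h.const_nonneg
  have step : ∀ n : ℕ, ℓ (g ^ (n + 1)) + 1 ≤ ℓ (g ^ (n + 2)) := by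
    intro n
    induction n with
    | zero => simp only [zero_add, pow_one]; linarith
    | succ n ih =>
      have e₁ : g⁻¹ * g ^ (n + 3) = g ^ (n + 2) := by rw [pow_succ' g (n + 2)]; group
      have e₂ : (g ^ 2)⁻¹ * g ^ (n + 3) = g ^ (n + 1) := by
        rw [show n + 3 = 2 + (n + 1) by ring, pow_add]; group
      have e₃ : g⁻¹ * g ^ 2 = g := by rw [pow_two]; group
      have := h.four_point 1 g (g ^ 2) (g ^ (n + 3))
      rw [inv_one, one_mul, one_mul, one_mul, e₁, e₂, e₃] at this
      -- The first alternative would give ℓ(g^(n+2)) + 1 ≤ ℓ(g^(n+1)), against the induction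
      -- hypothesis; the second is the claim.
      rcases this with h' | h' <;> rw [show n + 1 + 1 = n + 2 by ring] <;>
        rw [show n + 1 + 2 = n + 3 by ring] <;> linarith
  induction n with
  | zero => simp
  | succ n ih => have := step n; push_cast; linarith

/-- If `g²` is not much longer than `g`, then `g` is conjugate to a short element, by an element
of half the length of `g`. -/
lemma length_swap_le (h : IsHyperbolicLength ℓ D) {u v : G} (huv : ℓ u + ℓ v = ℓ (u * v))
    (hu : 2 * ℓ u ≤ ℓ (u * v)) (hu' : ℓ (u * v) ≤ 2 * ℓ u + 1)
    (hsq : ℓ ((u * v) ^ 2) ≤ ℓ (u * v) + D + 1) : ℓ (v * u) ≤ 3 * D + 2 := by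
  have hD := h.const_nonneg
  -- Geodesics from 1 to g = uv and to g⁻¹ stay close for about half their length, so their
  -- midpoints u and v⁻¹ are close; the distance between these is ℓ(vu). The point uv is compared
  -- first, to bound ℓ(uvu).
  have h₁ := h.four_point (u * v)⁻¹ (u * v) u 1
  have h₂ := h.four_point v⁻¹ (u * v)⁻¹ u 1
  have e₁ : (u * v)⁻¹ * u = v⁻¹ := by group
  have e₂ : v * (u * v)⁻¹ = u⁻¹ := by group
  simp only [inv_inv, mul_one, h.map_inv, ← pow_two, e₁] at h₁
  simp only [inv_inv, mul_one, h.map_inv, e₂] at h₂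
  rcases h₁ with h₁ | h₁ <;> rcases h₂ with h₂ | h₂ <;> linarith

/-- If `c` is short and moves `p` by at least twice the length of `p`, then there is little
cancellation in the products of `p⁻¹` with powers of `c`. -/
lemma length_add_le_inv_mul_zpow (h : IsHyperbolicLength ℓ D) {c p : G} {R : ℝ} (hc : ℓ c ≤ R)
    (hp : 2 * ℓ p ≤ ℓ (p⁻¹ * c * p)) (n : ℤ) :
    ℓ p + ℓ (c ^ n) ≤ ℓ (p⁻¹ * c ^ n) + R + D := by
  have h₁ := h.four_point p (c ^ n) (c * p) 1
  simp only [mul_one, h.map_inv, ← mul_assoc] at h₁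
  have h₂ := h.map_mul_le c p
  -- As c commutes with c^n, the point cp is at most ℓ(c) farther from c^n than p is.
  have h₃ : ℓ ((c ^ n)⁻¹ * c * p) ≤ ℓ (p⁻¹ * c ^ n) + ℓ c := by
    have e : ((c ^ n)⁻¹ * c * p)⁻¹ = p⁻¹ * c ^ n * c⁻¹ := by group
    rw [← h.map_inv, e, ← h.map_inv c]
    exact h.map_mul_le _ _
  rcases h₁ with h₁ | h₁ <;> linarith

/-- In the quadrilateral p, 1, c^n, c^n p both diagonals are nearly ℓ(p) + ℓ(c^n), by the previous
lemma for n and -n. The bound `hn` makes c^n too long for the diagonals to be controlled by the two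
sides of length ℓ(p), so the other pair of sides controls them. -/
lemma length_add_le_conj_pow (h : IsHyperbolicLength ℓ D) {c p : G} {R : ℝ} (hc : ℓ c ≤ R)
    (hp : 2 * ℓ p ≤ ℓ (p⁻¹ * c * p)) (n : ℕ) (hn : 2 * R + 3 * D < 2 * ℓ (c ^ n)) :
    2 * ℓ p + ℓ (c ^ n) ≤ ℓ (p⁻¹ * c ^ n * p) + 2 * R + 3 * D := by
  have h₁ := h.length_add_le_inv_mul_zpow hc hp n
  have h₂ := h.length_add_le_inv_mul_zpow hc hp (-n)
  have h₃ := h.four_point p 1 (c ^ n) (c ^ n * p)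
  have e : (c ^ n)⁻¹ * (c ^ n * p) = p := by group
  have e' : (p⁻¹ * (c ^ n)⁻¹)⁻¹ = c ^ n * p := by group
  rw [zpow_natCast] at h₁
  rw [zpow_neg, zpow_natCast, h.map_inv, ← h.map_inv (p⁻¹ * _), e'] at h₂
  simp only [inv_one, one_mul, mul_one, h.map_inv, e, ← mul_assoc] at h₃
  rcases h₃ with h₃ | h₃ <;> linarith

/-- The powers of c are pairwise distinct, and only finitely many fit in a ball. -/
lemma eventually_le_length_pow (h : IsHyperbolicLength ℓ D) {c : G} (hc : ¬ IsOfFinOrder c)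
    (B : ℝ) : ∀ᶠ n : ℕ in Filter.atTop, B < ℓ (c ^ n) := by
  have hfin : {n : ℕ | ℓ (c ^ n) ≤ B}.Finite :=
    (h.finite_ball B).preimage (injective_pow_iff_not_isOfFinOrder.2 hc).injOn
  rw [← Nat.cofinite_eq_atTop]
  filter_upwards [hfin.compl_mem_cofinite] with n hn
  simpa using hn

/-- In a torsion-free hyperbolic group, sufficiently high powers of nontrivial elements are longer
than the elements themselves by any prescribed amount, uniformly in the element. -/
theorem exists_pow_length_ge (h : IsHyperbolicLength ℓ D)
    (htf : ∀ g : G, g ≠ 1 → ¬ IsOfFinOrder g) (L : ℝ) :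
    ∃ k : ℕ, ∀ g : G, g ≠ 1 → ℓ g + L ≤ ℓ (g ^ k) := by
  have hD := h.const_nonneg
  set R := 3 * D + 2 with hR
  -- The first bound supplies the hypothesis of `length_add_le_conj_pow`; the second absorbs its
  -- error 2R + 3D and the 1 lost to the inexact midpoint. Finiteness of the ball lets one n serve
  -- all c.
  have hev : ∀ᶠ n : ℕ in Filter.atTop, ∀ c ∈ {c : G | ℓ c ≤ R}, c ≠ 1 →
      max (R + 2 * D) (L + 1 + 2 * R + 3 * D) < ℓ (c ^ n) := by
    rw [(h.finite_ball R).eventually_all]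
    intro c _
    by_cases hc : c = 1
    · simp [hc]
    · filter_upwards [h.eventually_le_length_pow (htf c hc) _] with n hn _ using hn
  obtain ⟨k, hk, hkL⟩ := (hev.and (Filter.eventually_ge_atTop (⌈L⌉₊ + 1))).exists
  refine ⟨k, fun g hg => ?_⟩
  by_cases hsq : ℓ g + D + 1 ≤ ℓ (g ^ 2)
  · have := h.add_le_pow_succ hsq (k - 1)
    rw [Nat.sub_add_cancel (by omega)] at this
    have h₂ : (⌈L⌉₊ : ℝ) ≤ ((k - 1 : ℕ) : ℝ) := by exact_mod_cast (by omega)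
    have := Nat.le_ceil L
    linarith
  · obtain ⟨u, v, rfl, huv, hu, hu'⟩ := h.exists_midpoint g
    have hc := h.length_swap_le huv hu hu' (not_le.1 hsq).le
    have hc1 : v * u ≠ 1 := fun e => hg (mul_eq_one_iff_eq_inv'.2 (eq_inv_of_mul_eq_one_left e))
    have hk' := hk _ hc hc1
    rw [max_lt_iff] at hk'
    have hp : u⁻¹⁻¹ * (v * u) * u⁻¹ = u * v := by group
    have := h.length_add_le_conj_pow (p := u⁻¹) hc (by rw [hp, h.map_inv]; exact hu) k
      (by linarith)
    have e : u⁻¹⁻¹ * (v * u) ^ k * u⁻¹ = (u * v) ^ k := by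
      rw [inv_inv, ← conj_pow]; congr 1; group
    rw [e, h.map_inv] at this
    linarith

end IsHyperbolicLength

/-! ### The word metric -/

section WordMetric

variable {G : Type*} [Group G] {X : Set G}

/-- Left translations are automorphisms of the Cayley graph. -/
def cayleyTranslation (X : Set G) (g : G) :
    SimpleGraph.mulCayley X →g SimpleGraph.mulCayley X where
  toFun := (g * ·)
  map_rel' := SimpleGraph.mulCayley_adj_mul_iff_right.2

lemma mulCayley_connected (hX : Subgroup.closure X = ⊤) : (SimpleGraph.mulCayley X).Connected := by
  have key : ∀ g : G, (SimpleGraph.mulCayley X).Reachable 1 g := by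
    intro g
    have hg : g ∈ Subgroup.closure X := hX ▸ Subgroup.mem_top g
    induction hg using Subgroup.closure_induction with
    | mem x hx =>
      by_cases h1 : (1 : G) = x
      · rw [h1]
      · exact (((SimpleGraph.mulCayley_adj X 1 x).2 ⟨h1, by simp [hx]⟩)).reachable
    | one => rfl
    | mul x y _ _ hx hy =>
      have := hy.map (cayleyTranslation X x)
      simp only [cayleyTranslation, RelHom.coeFn_mk, mul_one] at this
      exact hx.trans this
    | inv x _ hx =>
      have := hx.map (cayleyTranslation X x⁻¹)
      simp only [cayleyTranslation, RelHom.coeFn_mk, mul_one, inv_mul_cancel] at this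
      exact this.symm
  exact ⟨fun g h => (key g).symm.trans (key h)⟩

lemma mulCayley_dist_mul_le (hX : Subgroup.closure X = ⊤) (g x y : G) :
    (SimpleGraph.mulCayley X).dist (g * x) (g * y) ≤ (SimpleGraph.mulCayley X).dist x y := by
  obtain ⟨w, hw⟩ := (mulCayley_connected hX).exists_walk_length_eq_dist x y
  rw [← hw, ← SimpleGraph.Walk.length_map (cayleyTranslation X g) w]
  exact SimpleGraph.dist_le _

lemma mulCayley_dist_eq (hX : Subgroup.closure X = ⊤) (x y : G) :
    (SimpleGraph.mulCayley X).dist x y = (SimpleGraph.mulCayley X).dist 1 (x⁻¹ * y) := by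
  refine le_antisymm ?_ ?_
  · simpa using mulCayley_dist_mul_le hX x 1 (x⁻¹ * y)
  · simpa using mulCayley_dist_mul_le hX x⁻¹ x y

/-- Every element of word length `m + n` is a product of elements of word lengths `m` and `n`. -/
lemma exists_mul_of_mulCayley_dist (hX : Subgroup.closure X = ⊤) {g : G} {m n : ℕ}
    (hg : (SimpleGraph.mulCayley X).dist 1 g = m + n) :
    ∃ u v, g = u * v ∧ (SimpleGraph.mulCayley X).dist 1 u = m ∧
      (SimpleGraph.mulCayley X).dist 1 v = n := by
  obtain ⟨w, hw⟩ := (mulCayley_connected hX).exists_walk_length_eq_dist 1 g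
  refine ⟨w.getVert m, (w.getVert m)⁻¹ * g, by group, ?_⟩
  rw [← mulCayley_dist_eq hX]
  have h₁ := SimpleGraph.dist_le (w.take m)
  have h₂ := SimpleGraph.dist_le (w.drop m)
  have h₃ := (mulCayley_connected hX).dist_triangle (u := 1) (v := w.getVert m) (w := g)
  rw [SimpleGraph.Walk.take_length] at h₁
  rw [SimpleGraph.Walk.drop_length] at h₂
  omega

lemma finite_mulCayley_ball (hfin : X.Finite) (hX : Subgroup.closure X = ⊤) (n : ℕ) :
    {g | (SimpleGraph.mulCayley X).dist 1 g ≤ n}.Finite := by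
  induction n with
  | zero =>
    refine (Set.finite_singleton (1 : G)).subset fun g hg => ?_
    exact ((mulCayley_connected hX).dist_eq_zero_iff.1 (Nat.le_zero.1 hg)).symm
  | succ n ih =>
    refine (ih.union (Set.Finite.image2 (· * ·) ih (hfin.union hfin.inv))).subset fun g hg => ?_
    rcases Nat.lt_or_ge n ((SimpleGraph.mulCayley X).dist 1 g) with h | h
    · obtain ⟨u, v, rfl, hu, hv⟩ :=
        exists_mul_of_mulCayley_dist hX (m := n) (n := 1) (le_antisymm hg h)
      rw [SimpleGraph.dist_eq_one_iff_adj, SimpleGraph.mulCayley_adj] at hv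
      refine Or.inr ⟨u, hu.le, v, ?_, rfl⟩
      simpa using hv.2
    · exact Or.inl h

/-- A word hyperbolic group has a hyperbolic length function. -/
theorem IsWordHyperbolic.exists_isHyperbolicLength (hG : IsWordHyperbolic G) :
    ∃ (ℓ : G → ℝ) (D : ℝ), IsHyperbolicLength ℓ D := by
  obtain ⟨X, hfin, hX, δ, hδ⟩ := hG
  have hconn := mulCayley_connected hX
  have hinv : ∀ x y : G, ((SimpleGraph.mulCayley X).dist x y : ℝ) =
      (SimpleGraph.mulCayley X).dist 1 (x⁻¹ * y) := fun x y => by rw [← mulCayley_dist_eq hX]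
  -- Clearing the factor 1/2 in the Gromov products turns `δ` into `2 * δ`.
  refine ⟨fun g => (SimpleGraph.mulCayley X).dist 1 g, 2 * δ, ?_, ?_, ?_, ?_, ?_, ?_⟩
  · simp
  · intro g
    rw [SimpleGraph.dist_comm, mulCayley_dist_eq hX, inv_inv, mul_one]
  · intro g h
    have := hconn.dist_triangle (u := 1) (v := g) (w := g * h)
    rw [mulCayley_dist_eq hX g, inv_mul_cancel_left] at this
    exact_mod_cast this
  · intro x y z w
    have := hδ w x y z
    simp only [gromovProduct] at this
    simp only [← hinv]
    rw [sub_le_iff_le_add, min_le_iff] at this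
    rcases this with h | h
    · left; linarith
    · right; linarith
  · intro R
    refine (finite_mulCayley_ball hfin hX ⌊R⌋₊).subset fun g hg => ?_
    exact Nat.le_floor hg
  · intro g
    obtain ⟨u, v, rfl, hu, hv⟩ := exists_mul_of_mulCayley_dist hX (g := g)
      (m := (SimpleGraph.mulCayley X).dist 1 g / 2)
      (n := (SimpleGraph.mulCayley X).dist 1 g - (SimpleGraph.mulCayley X).dist 1 g / 2) (by omega)
    refine ⟨u, v, rfl, ?_, ?_, ?_⟩ <;> norm_cast <;> omega

end WordMetric

/-! ### Splitting words -/

namespace HEWord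

/-- The projection only depends on the letters of small index. -/
lemma proj_eq_of_strictMono (N : ℕ) (U V : HEWord) (e : U.Dom → V.Dom) (he : StrictMono e)
    (hletter : ∀ t, V.letter (e t) = U.letter t)
    (hrange : ∀ t, (V.letter t).1 ≤ N → t ∈ Set.range e) : proj N V = proj N U := by
  rw [proj_eq_of_list N V (((U.positions N).sort (· ≤ ·)).map e), List.map_map, proj]
  · congr 2
    exact funext fun t => congrArg (letterVal N) (hletter t)
  · rw [List.pairwise_map]
    exact (pairwise_sort_lt U N).imp fun h => he h
  · intro t
    simp only [List.mem_map, Finset.mem_sort, mem_positions]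
    constructor
    · rintro ⟨u, hu, rfl⟩
      rwa [hletter]
    · intro h
      obtain ⟨u, rfl⟩ := hrange t h
      exact ⟨u, by rwa [hletter] at h, rfl⟩

/-- The restriction of a word to a set of positions. -/
def restrict (W : HEWord) (s : Set W.Dom) : HEWord where
  Dom := s
  letter t := W.letter t
  finite_letter n := (W.finite_letter n).preimage Subtype.val_injective.injOn

/-- Every word splits at each of its positions. -/
lemma proj_eq_split (N : ℕ) (W : HEWord) (t : W.Dom) :
    proj N W = proj N (W.restrict (Set.Iio t)) * proj N (single (W.letter t)) *
      proj N (W.restrict (Set.Ioi t)) := by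
  rw [← proj_concat, ← proj_concat]
  let e : ((Set.Iio t) ⊕ₗ Unit) ⊕ₗ (Set.Ioi t) → W.Dom := fun x =>
    Sum.elim (fun y => Sum.elim Subtype.val (fun _ => t) (ofLex y)) Subtype.val (ofLex x)
  refine proj_eq_of_strictMono N _ W e ?_ ?_ ?_
  · intro x y hxy
    rcases x with (⟨x, hx⟩ | x) | ⟨x, hx⟩ <;> rcases y with (⟨y, hy⟩ | y) | ⟨y, hy⟩
    · have h : (⟨x, hx⟩ : Set.Iio t) < ⟨y, hy⟩ :=
        Sum.Lex.inl_lt_inl_iff.1 (Sum.Lex.inl_lt_inl_iff.1 hxy)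
      exact h
    · exact hx
    · exact lt_trans hx hy
    · exact absurd (Sum.Lex.inl_lt_inl_iff.1 hxy) Sum.Lex.not_inr_lt_inl
    · exact absurd (Sum.Lex.inr_lt_inr_iff.1 (Sum.Lex.inl_lt_inl_iff.1 hxy)) (lt_irrefl _)
    · exact hy
    · exact absurd hxy Sum.Lex.not_inr_lt_inl
    · exact absurd hxy Sum.Lex.not_inr_lt_inl
    · have h : (⟨x, hx⟩ : Set.Ioi t) < ⟨y, hy⟩ := Sum.Lex.inr_lt_inr_iff.1 hxy
      exact h
  · rintro ((x | x) | x) <;> rfl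
  · intro s _
    rcases lt_trichotomy s t with h | rfl | h
    · exact ⟨toLex (Sum.inl (toLex (Sum.inl ⟨s, h⟩))), rfl⟩
    · exact ⟨toLex (Sum.inl (toLex (Sum.inr ()))), rfl⟩
    · exact ⟨toLex (Sum.inr ⟨s, h⟩), rfl⟩

lemma proj_single (N : ℕ) (x : ℕ × Bool) : proj N (single x) = letterVal N x := by
  by_cases h : x.1 ≤ N
  · rw [proj_eq_of_list N (single x) [()] (List.pairwise_singleton _ _)]
    · simp [single]
    · intro t
      exact iff_of_true (List.mem_singleton.2 rfl) h
  · rw [proj_eq_of_list N (single x) [] List.Pairwise.nil]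
    · simp [letterVal, h]
    · intro t
      exact iff_of_false List.not_mem_nil h

lemma proj_eq_one (N : ℕ) (W : HEWord) (hW : ∀ t, N < (W.letter t).1) : proj N W = 1 := by
  rw [proj_eq_of_list N W [] List.Pairwise.nil fun t =>
    iff_of_false List.not_mem_nil (not_le.2 (hW t))]
  simp

end HEWord

namespace HEG

lemma mk_single_eq_incl (N : ℕ) (x : ℕ × Bool) (hx : x.1 ≤ N) :
    mk (HEWord.single x) = incl N (proj N (mk (HEWord.single x))) := by
  have h : proj N (mk (HEWord.single x)) = HEWord.letterVal N x := HEWord.proj_single N x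
  obtain ⟨n, b⟩ := x
  rw [h, HEWord.letterVal, dif_pos hx]
  cases b
  · have e : mk (HEWord.single (n, false)) = (mk (HEWord.single (n, true)))⁻¹ :=
      Quotient.sound fun M => by
        rw [HEWord.proj_inverse, HEWord.proj_single, HEWord.proj_single, ← HEWord.letterVal_inv]
        rfl
    rw [e]
    simp [incl]
  · simp [incl]

/-- A homomorphism that kills all words in letters of index greater than `N` factors through the
projection to the letters of index at most `N`. -/
lemma eq_comp_proj {G : Type*} [Group G] (φ : HEG →* G) (N : ℕ)
    (hφ : ∀ W : HEWord, (∀ t, N < (W.letter t).1) → φ (mk W) = 1) :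
    φ = φ.comp ((incl N).comp (proj N)) := by
  -- Induction on the number of letters of index at most N, which is finite: splitting at one of
  -- them leaves two words with fewer.
  have key : ∀ (m : ℕ) (W : HEWord), {t | (W.letter t).1 ≤ N}.ncard ≤ m →
      φ (mk W) = φ.comp ((incl N).comp (proj N)) (mk W) := by
    intro m
    induction m with
    | zero =>
      intro W hW
      rw [Nat.le_zero, Set.ncard_eq_zero (W.finite_le N)] at hW
      have hW' : ∀ t, N < (W.letter t).1 := fun t => not_le.1 fun ht =>
        (Set.eq_empty_iff_forall_notMem.1 hW t) ht
      have : proj N (mk W) = 1 := HEWord.proj_eq_one N W hW'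
      simp [hφ W hW', this]
    | succ m ih =>
      intro W hW
      by_cases hne : ∃ t, (W.letter t).1 ≤ N
      · obtain ⟨t, ht⟩ := hne
        have hsplit : mk W = mk (W.restrict (Set.Iio t)) * mk (HEWord.single (W.letter t)) *
            mk (W.restrict (Set.Ioi t)) :=
          Quotient.sound fun M => by
            rw [HEWord.proj_concat, HEWord.proj_concat]
            exact HEWord.proj_eq_split M W t
        have hcard : ∀ s : Set W.Dom, t ∉ s →
            {x | ((W.restrict s).letter x).1 ≤ N}.ncard ≤ m := by
          intro s hs
          let f : (W.restrict s).Dom → W.Dom := Subtype.val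
          have hlt : (Set.image f {x | ((W.restrict s).letter x).1 ≤ N}).ncard <
              {x | (W.letter x).1 ≤ N}.ncard := by
            refine Set.ncard_lt_ncard ⟨?_, ?_⟩ (W.finite_le N)
            · rintro _ ⟨x, hx, rfl⟩
              exact hx
            · intro hsub
              obtain ⟨x, -, hx⟩ := hsub ht
              exact hs (hx ▸ Subtype.property (p := (· ∈ s)) x)
          have hf : Function.Injective f := Subtype.val_injective
          rw [Set.ncard_image_of_injective _ hf] at hlt
          omega
        rw [hsplit, map_mul, map_mul, map_mul, map_mul, ih _ (hcard (Set.Iio t) (lt_irrefl t)),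
          ih _ (hcard (Set.Ioi t) (lt_irrefl t))]
        congr 2
        exact congrArg φ (mk_single_eq_incl N _ ht)
      · refine ih W ?_
        have : {t | (W.letter t).1 ≤ N} = ∅ :=
          Set.eq_empty_iff_forall_notMem.2 fun t ht => hne ⟨t, ht⟩
        simp [this]
  ext ⟨W⟩
  exact key _ W le_rfl

end HEG

/-! ### Solving infinite systems of equations in the Hawaiian earring group -/

/-- The positions of the infinite word `X n` that is determined by the recursion
`X n = W n · X (n + 1) ^ k n`. -/
inductive NestedPos (W : ℕ → HEWord) (k : ℕ → ℕ) : ℕ → Type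
  | here {n : ℕ} : (W n).Dom → NestedPos W k n
  | there {n : ℕ} : Fin (k n) → NestedPos W k (n + 1) → NestedPos W k n

namespace NestedPos

variable {W : ℕ → HEWord} {k : ℕ → ℕ}

/-- The order on the positions: those of `W n` come first, followed by the copies of the positions
of `X (n + 1)` one after the other. -/
def lt : ∀ {n : ℕ}, NestedPos W k n → NestedPos W k n → Prop
  | _, here s, here t => s < t
  | _, here _, there _ _ => True
  | _, there _ _, here _ => False
  | _, there i p, there j q => i < j ∨ i = j ∧ lt p q

lemma lt_irrefl {n : ℕ} (p : NestedPos W k n) : ¬ lt p p := by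
  induction p with
  | here t => simp [lt]
  | there i p ih => simp [lt, ih]

lemma lt_trans {n : ℕ} (p q r : NestedPos W k n) : lt p q → lt q r → lt p r := by
  induction p with
  | here s =>
    cases q <;> cases r <;> simp only [lt, false_implies, implies_true]
    exact fun h h' => h.trans h'
  | there i p ih =>
    rcases q with _ | ⟨j, q⟩ <;> rcases r with _ | ⟨l, r⟩ <;>
      simp only [lt, false_implies, implies_true]
    rintro (h | ⟨rfl, h⟩) (h' | ⟨rfl, h'⟩)
    · exact Or.inl (h.trans h')
    · exact Or.inl h
    · exact Or.inl h'
    · exact Or.inr ⟨rfl, ih q r h h'⟩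

lemma lt_trichotomy {n : ℕ} (p q : NestedPos W k n) : lt p q ∨ p = q ∨ lt q p := by
  induction p with
  | here s =>
    cases q with
    | here t => simpa [lt] using _root_.lt_trichotomy s t
    | there j q => simp [lt]
  | there i p ih =>
    rcases q with _ | ⟨j, q⟩
    · simp [lt]
    · rcases _root_.lt_trichotomy i j with h | rfl | h
      · exact Or.inl (Or.inl h)
      · rcases ih q with h | rfl | h
        · exact Or.inl (Or.inr ⟨rfl, h⟩)
        · exact Or.inr (Or.inl rfl)
        · exact Or.inr (Or.inr (Or.inr ⟨rfl, h⟩))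
      · exact Or.inr (Or.inr (Or.inl h))

instance {n : ℕ} : IsStrictTotalOrder (NestedPos W k n) lt where
  irrefl := lt_irrefl
  trans := lt_trans
  trichotomous p q h h' := ((lt_trichotomy p q).resolve_left h).resolve_right h'

open Classical in
noncomputable instance {n : ℕ} : LinearOrder (NestedPos W k n) := linearOrderOfSTO lt

/-- The letter at a position. -/
def letter : ∀ {n : ℕ}, NestedPos W k n → ℕ × Bool
  | n, here t => (W n).letter t
  | _, there _ p => letter p

lemma le_letter (hW : ∀ n t, n ≤ ((W n).letter t).1) {n : ℕ} (p : NestedPos W k n) :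
    n ≤ (letter p).1 := by
  induction p with
  | here t => exact hW _ t
  | there i p ih => exact (Nat.le_succ _).trans ih

/-- Each unfolding of the recursion makes finitely many copies and raises the least possible index
by one, so a given index cannot occur beyond a bounded depth. The induction is on the number j of
levels until indices exceed m. -/
lemma finite_letter (hW : ∀ n t, n ≤ ((W n).letter t).1) (m n : ℕ) :
    {p : NestedPos W k n | (letter p).1 = m}.Finite := by
  obtain ⟨j, hj⟩ : ∃ j, m < n + j := ⟨m + 1, by omega⟩
  induction j generalizing n with
  | zero =>
    refine Set.finite_empty.subset fun p hp => ?_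
    have h₁ := le_letter hW p
    have h₂ : (letter p).1 = m := hp
    omega
  | succ j ih =>
    have hfin := ih (n + 1) (by omega)
    refine ((((W n).finite_letter m).image here).union
      (Set.finite_iUnion fun i => hfin.image (there i))).subset fun p hp => ?_
    cases p with
    | here t => exact Or.inl ⟨t, hp, rfl⟩
    | there i p => exact Or.inr (Set.mem_iUnion.2 ⟨i, p, hp, rfl⟩)

/-- The infinite word `X n` determined by the recursion `X n = W n · X (n + 1) ^ k n`. -/
noncomputable def word (hW : ∀ n t, n ≤ ((W n).letter t).1) (n : ℕ) : HEWord where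
  Dom := NestedPos W k n
  countable := by
    rw [← Set.countable_univ_iff]
    have : (Set.univ : Set (NestedPos W k n)) = ⋃ m, {p | (letter p).1 = m} := by ext; simp
    rw [this]
    exact Set.countable_iUnion fun m => (finite_letter hW m n).countable
  letter := letter
  finite_letter m := finite_letter hW m n

lemma proj_word (hW : ∀ n t, n ≤ ((W n).letter t).1) (N n : ℕ) :
    HEWord.proj N (word (k := k) hW n) =
      HEWord.proj N (W n) * HEWord.proj N (word (k := k) hW (n + 1)) ^ k n := by
  let X := word (k := k) hW
  let f : (W n).Dom → (X n).Dom := here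
  let g : Fin (k n) → (X (n + 1)).Dom → (X n).Dom := there
  let l := ((X (n + 1)).positions N).sort (· ≤ ·)
  let l₀ : List (X n).Dom := (((W n).positions N).sort (· ≤ ·)).map f
  let l₁ : List (X n).Dom := (List.finRange (k n)).flatMap fun i => l.map (g i)
  change HEWord.proj N (X n) = HEWord.proj N (W n) * HEWord.proj N (X (n + 1)) ^ k n
  rw [HEWord.proj_eq_of_list N (X n) (l₀ ++ l₁), List.map_append, List.prod_append]
  · congr 1
    · simp only [l₀, List.map_map]
      rfl
    · have hcopy : ∀ i : Fin (k n), ((l.map (g i)).map fun t =>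
          HEWord.letterVal N ((X n).letter t)).prod = HEWord.proj N (X (n + 1)) := fun i => by
        rw [List.map_map]
        rfl
      simp only [l₁, List.flatMap_def, List.map_flatten, List.prod_flatten, List.map_map,
        Function.comp_def] at hcopy ⊢
      simp [hcopy]
  · rw [List.pairwise_append]
    refine ⟨?_, ?_, ?_⟩
    · rw [List.pairwise_map]
      exact (HEWord.pairwise_sort_lt (W n) N).imp fun h => h
    · rw [List.pairwise_flatMap]
      refine ⟨fun i _ => ?_, ?_⟩
      · rw [List.pairwise_map]
        exact (HEWord.pairwise_sort_lt (X (n + 1)) N).imp fun h => Or.inr ⟨rfl, h⟩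
      · refine (List.pairwise_lt_finRange _).imp fun {i j} hij => ?_
        simp only [List.mem_map]
        rintro _ ⟨p, -, rfl⟩ _ ⟨q, -, rfl⟩
        exact Or.inl hij
    · intro p hp q hq
      obtain ⟨s, -, rfl⟩ := List.mem_map.1 hp
      obtain ⟨i, -, hq⟩ := List.mem_flatMap.1 hq
      obtain ⟨q, -, rfl⟩ := List.mem_map.1 hq
      exact trivial
  · intro p
    simp only [l₀, l₁, l, List.mem_append, List.mem_flatMap, List.mem_map, Finset.mem_sort,
      HEWord.mem_positions, List.mem_finRange, true_and]
    constructor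
    · rintro (⟨t, ht, rfl⟩ | ⟨i, q, hq, rfl⟩)
      · exact ht
      · exact hq
    · intro hp
      rcases p with t | ⟨i, q⟩
      · exact Or.inl ⟨t, hp, rfl⟩
      · exact Or.inr ⟨i, q, hp, rfl⟩

end NestedPos

/-- Systems of equations `x n = w n * x (n + 1) ^ k n` have solutions in the Hawaiian earring
group if the letters occurring in `w n` have index at least `n`. -/
theorem HEG.exists_nested_powers (W : ℕ → HEWord) (k : ℕ → ℕ)
    (hW : ∀ n t, n ≤ ((W n).letter t).1) :
    ∃ x : ℕ → HEG, ∀ n, x n = mk (W n) * x (n + 1) ^ k n := by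
  refine ⟨fun n => mk (NestedPos.word (k := k) hW n), fun n => ?_⟩
  have hproj : ∀ x y : HEG, (∀ N, proj N x = proj N y) → x = y := by
    rintro ⟨U⟩ ⟨V⟩ h
    exact Quotient.sound h
  refine hproj _ _ fun N => ?_
  rw [map_mul, map_pow]
  exact NestedPos.proj_word hW N n

/-! ### Noncommutative slenderness -/

theorem theorem1 {G : Type*} [Group G] (hG : IsWordHyperbolic G)
    (htf : ∀ g : G, g ≠ 1 → ¬ IsOfFinOrder g) : IsNSlender G := by
  intro φ
  by_contra! hφ
  have hW : ∀ N : ℕ, ∃ W : HEWord, (∀ t, N < (W.letter t).1) ∧ φ (HEG.mk W) ≠ 1 := by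
    intro N
    by_contra! h
    exact hφ N (HEG.eq_comp_proj φ N h)
  choose W hWN hW1 using hW
  obtain ⟨ℓ, D, hℓ⟩ := hG.exists_isHyperbolicLength
  -- The summand ℓ(φ(w_n)) pays for cancelling w_n in the equation; the extra 1 makes the lengths
  -- drop.
  choose k hk using fun n => hℓ.exists_pow_length_ge htf (ℓ (φ (HEG.mk (W n))) + 1)
  obtain ⟨x, hx⟩ := HEG.exists_nested_powers W k fun n t => (hWN n t).le
  have hy : ∀ n, φ (x n) = φ (HEG.mk (W n)) * φ (x (n + 1)) ^ k n := fun n => by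
    rw [← map_pow, ← map_mul, ← hx n]
  have hpow : ∀ n, ℓ (φ (x (n + 1)) ^ k n) ≤ ℓ (φ (HEG.mk (W n))) + ℓ (φ (x n)) := fun n => by
    rw [eq_inv_mul_of_mul_eq (hy n).symm, ← hℓ.map_inv (φ (HEG.mk (W n)))]
    exact hℓ.map_mul_le _ _
  have hne : ∀ n, φ (x n) ≠ 1 := by
    intro n hn
    -- If φ(x_n) = 1, then φ(x_{n+1})^{k_n} is the inverse of φ(w_n): too short for a power of a
    -- nontrivial element, yet not 1.
    by_cases hn' : φ (x (n + 1)) = 1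
    · have := hy n
      rw [hn, hn', one_pow, mul_one] at this
      exact hW1 n this.symm
    · have h₁ := hk n _ hn'
      have h₂ := hpow n
      have h₃ := hℓ.nonneg (φ (x (n + 1)))
      rw [hn, hℓ.map_one] at h₂
      linarith
  have hdesc : ∀ n : ℕ, ℓ (φ (x n)) + n ≤ ℓ (φ (x 0)) := by
    intro n
    induction n with
    | zero => simp
    | succ n ih =>
      have h₁ := hk n _ (hne (n + 1))
      have h₂ := hpow n
      push_cast
      linarith
  obtain ⟨n, hn⟩ := exists_nat_gt (ℓ (φ (x 0)))
  have h₁ := hdesc n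
  have h₂ := hℓ.nonneg (φ (x n))
  linarith
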